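/- Let $R$ be a commutative noetherian ring, $I$ an ideal of $R$, and $\operatorname{mod}R$ the category of finitely generated $R$-modules. All subcategories are full and closed under isomorphism. For a finitely generated $R$-module $M$, let $\underline{\operatorname{End}}_R(M)$ be the quotient of $\operatorname{End}_R(M)$ by the endomorphisms that factor through a finitely generated projective $R$-module, and let $\underline{\operatorname{ann}}_R(M)$ be the annihilator of the $R$-module $\underline{\operatorname{End}}_R(M)$. Let $\operatorname{mod}_I(R)$ be the subcategory of $\operatorname{mod}R$ of all $M$ with $I\subseteq\underline{\operatorname{ann}}_R(M)$. Put $\mathrm{V}(I)=\{\mathfrak p\in\operatorname{Spec}R\mid I\subseteq\mathfrak p\}$ and let $\operatorname{mod}_{\mathrm{V}(I)}(R)$ be the subcategory of $\operatorname{mod}R$ of all $M$ such that $M_{\mathfrak p}$ is a free $R_{\mathfrak p}$-module for every $\mathfrak p\in\operatorname{Spec}R\setminus\mathrm{V}(I)$. For a subcategory $\mathcal X$ of $\operatorname{mod}R$, let $\operatorname{ext}_R\mathcal X$ be the smallest subcategory of $\operatorname{mod}R$ that contains $\mathcal X$ and is closed under finite direct sums, direct summands and extensions. Then \[ \operatorname{ext}_R(\operatorname{mod}_I(R))=\operatorname{mod}_{\mathrm{V}(I)}(R).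 \] In particular, $\operatorname{mod}_I(R)$ is closed under extensions if and only if $\operatorname{mod}_I(R)=\operatorname{mod}_{\mathrm{V}(I)}(R)$. -/

import Mathlib

open CategoryTheory

universe u

namespace StableAnn

/-- The endomorphisms of the `R`-module `M` that factor through a finitely generated projective
`R`-module. -/
def factorsThroughProjective (R : Type u) [CommRing R] (M : Type u) [AddCommGroup M] [Module R M] :
    Submodule R (M →ₗ[R] M) where
  carrier := {f | ∃ (P : Type u) (_ : AddCommGroup P) (_ : Module R P),
    Module.Finite R P ∧ Module.Projective R P ∧
      ∃ (g : M →ₗ[R] P) (h : P →ₗ[R] M), f = h ∘ₗ g}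
  add_mem' := by
    rintro _ _ ⟨P, _, _, _, _, g, h, rfl⟩ ⟨P', _, _, _, _, g', h', rfl⟩
    exact ⟨P × P', inferInstance, inferInstance, inferInstance, inferInstance,
      g.prod g', h.coprod h', by ext x; simp⟩
  zero_mem' := ⟨PUnit, inferInstance, inferInstance, inferInstance, inferInstance, 0, 0, by simp⟩
  smul_mem' := by
    rintro a _ ⟨P, _, _, hP, hP', g, h, rfl⟩
    exact ⟨P, _, _, hP, hP', g, a • h, by ext x; simp⟩

/-- The stable endomorphism module of `M`: endomorphisms of `M` modulo those factoring through a
finitely generated projective module. -/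
abbrev StableEnd (R : Type u) [CommRing R] (M : Type u) [AddCommGroup M] [Module R M] : Type u :=
  (M →ₗ[R] M) ⧸ factorsThroughProjective R M

/-- The stable annihilator of `M`: the annihilator of its stable endomorphism module. -/
def stableAnnihilator (R : Type u) [CommRing R] (M : Type u) [AddCommGroup M] [Module R M] :
    Ideal R :=
  Module.annihilator R (StableEnd R M)

/-- The nonfree locus of `M`: the primes `p` such that `M_p` is not a free `R_p`-module. -/
def nonfreeLocus (R : Type u) [CommRing R] (M : Type u) [AddCommGroup M] [Module R M] :
    Set (PrimeSpectrum R) :=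
  {p | ¬ Module.Free (Localization.AtPrime p.asIdeal) (LocalizedModule p.asIdeal.primeCompl M)}

/-- `mod_I(R)`: the finitely generated modules whose stable annihilator contains `I`. -/
def modIdeal (R : Type u) [CommRing R] (I : Ideal R) : ObjectProperty (FGModuleCat.{u} R) :=
  fun M => I ≤ stableAnnihilator R M

/-- `mod_Φ(R)`: the finitely generated modules whose nonfree locus is contained in `Φ`. -/
def modLocus (R : Type u) [CommRing R] (Φ : Set (PrimeSpectrum R)) :
    ObjectProperty (FGModuleCat.{u} R) :=
  fun M => nonfreeLocus R M ⊆ Φ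

/-- `ext_R X`: the smallest full subcategory of `mod R` that contains `X` and is closed under
finite direct sums, direct summands and extensions, as the intersection of all of these. (Closure
under direct summands includes closure under isomorphism.) -/
def extClosure (R : Type u) [CommRing R] [IsNoetherianRing R]
    (X : ObjectProperty (FGModuleCat.{u} R)) : ObjectProperty (FGModuleCat.{u} R) :=
  fun M => ∀ P : ObjectProperty (FGModuleCat.{u} R), X ≤ P → P.IsClosedUnderFiniteProducts →
    P.IsStableUnderRetracts → P.IsClosedUnderExtensions → P M

end StableAnn

/-!
The nonfree locus of `M` is the support of its stable endomorphism module, so `M` lies in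
`mod_{V(I)}` exactly when `I` is contained in the radical of the stable annihilator
(`StableAnn.nonfreeLocus_subset_zeroLocus_iff`). Stable annihilators grow along retracts, and in an
extension the product of the outer ones annihilates the middle, so this condition is stable under
retracts and extensions, hence under finite products.

For the other inclusion, take a finite free cover `π : F → M` and let `W x` be the pullback of `π`
along multiplication by `x` on `M` (`StableAnn.smulPullback`), which plays the role of a syzygy of
the Koszul complex `x : M → M`. Three facts about it suffice.

* Both `x` and the stable annihilator of `M` annihilate `W x` stably.
* If `x ^ n` annihilates `M` stably, then `M` is a direct summand of `W (x ^ n)`.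
* There are exact sequences `0 → W (x ^ n) → W (x ^ (n + 1)) × F → W x → 0`, so `W (x ^ n)` is built
  from `W x` and projective modules by extensions and direct summands.

If `I` is contained in the radical of the stable annihilator of `M` but not in the stable
annihilator itself, an `x ∈ I` outside the latter gives a `W x` with a strictly larger stable
annihilator, and Noetherian induction applies (`StableAnn.prop_of_le_radical`).
-/

namespace StableAnn

/-! ### Stable annihilators -/

section Algebra

variable {R : Type u} [CommRing R]

lemma mem_stableAnnihilator_iff {M : Type u} [AddCommGroup M] [Module R M] {a : R} :
    a ∈ stableAnnihilator R M ↔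
      ∃ (P : Type u) (_ : AddCommGroup P) (_ : Module R P),
        Module.Finite R P ∧ Module.Projective R P ∧
          ∃ (g : M →ₗ[R] P) (h : P →ₗ[R] M), ∀ m, h (g m) = a • m := by
  rw [stableAnnihilator, Module.mem_annihilator]
  constructor
  · intro H
    have h1 := H (Submodule.Quotient.mk LinearMap.id)
    rw [← Submodule.Quotient.mk_smul, Submodule.Quotient.mk_eq_zero] at h1
    obtain ⟨P, _, _, hP, hP', g, h, e⟩ := h1
    exact ⟨P, _, _, hP, hP', g, h, fun m => (LinearMap.congr_fun e m).symm⟩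
  · rintro ⟨P, _, _, hP, hP', g, h, e⟩ f
    obtain ⟨f, rfl⟩ := Submodule.Quotient.mk_surjective _ f
    rw [← Submodule.Quotient.mk_smul, Submodule.Quotient.mk_eq_zero]
    exact ⟨P, _, _, hP, hP', g ∘ₗ f, h, by ext m; simp [e]⟩

lemma stableAnnihilator_eq_top {M : Type u} [AddCommGroup M] [Module R M] [Module.Finite R M]
    [Module.Projective R M] : stableAnnihilator R M = ⊤ := by
  rw [Ideal.eq_top_iff_one, mem_stableAnnihilator_iff]
  exact ⟨M, _, _, inferInstance, inferInstance, LinearMap.id, LinearMap.id, by simp⟩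

lemma stableAnnihilator_le_of_retract {M N : Type u} [AddCommGroup M] [Module R M]
    [AddCommGroup N] [Module R N] (i : M →ₗ[R] N) (r : N →ₗ[R] M) (hri : ∀ m, r (i m) = m) :
    stableAnnihilator R N ≤ stableAnnihilator R M := by
  intro a ha
  rw [mem_stableAnnihilator_iff] at ha ⊢
  obtain ⟨P, _, _, hP, hP', g, h, e⟩ := ha
  exact ⟨P, _, _, hP, hP', g ∘ₗ i, r ∘ₗ h, by simp [e, hri]⟩

/-- If `b • id_N` factors through `Q` projective, lifting `Q → N` along `p` makes `b • id_M`
differ from a map through `Q` by a map `M → L`, to which `a • id_L` applies. -/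
lemma stableAnnihilator_mul_le {L M N : Type u} [AddCommGroup L] [Module R L] [AddCommGroup M]
    [Module R M] [AddCommGroup N] [Module R N] {i : L →ₗ[R] M} {p : M →ₗ[R] N}
    (hi : Function.Injective i) (hip : Function.Exact i p) (hp : Function.Surjective p) :
    stableAnnihilator R L * stableAnnihilator R N ≤ stableAnnihilator R M := by
  rw [Ideal.mul_le]
  intro a ha b hb
  rw [mem_stableAnnihilator_iff] at ha hb ⊢
  obtain ⟨P, _, _, hP, hP', g, h, e⟩ := ha
  obtain ⟨Q, _, _, hQ, hQ', g', h', e'⟩ := hb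
  obtain ⟨l, hl⟩ := Module.projective_lifting_property p h' hp
  replace hl : ∀ q, p (l q) = h' q := LinearMap.congr_fun hl
  let d : M →ₗ[R] M := b • LinearMap.id - l ∘ₗ g' ∘ₗ p
  have hd : ∀ m, d m ∈ LinearMap.range i := fun m => (hip _).1 (by simp [d, hl, e'])
  let t : M →ₗ[R] L := (LinearEquiv.ofInjective i hi).symm ∘ₗ d.codRestrict _ hd
  have ht : ∀ m, i (t m) = b • m - l (g' (p m)) := fun m =>
    congrArg Subtype.val
      ((LinearEquiv.ofInjective i hi).apply_symm_apply (d.codRestrict _ hd m))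
  refine ⟨P × Q, inferInstance, inferInstance, inferInstance, inferInstance,
    (g ∘ₗ t).prod (g' ∘ₗ p), (i ∘ₗ h).coprod (a • l), fun m => ?_⟩
  simp [e, ht, smul_sub, mul_smul]

/-! ### Pullbacks along multiplication maps -/

/-- The pullback of `π : F → M` along multiplication by `x` on `M`. For `F` projective and `π`
surjective this is, in the stable category, a syzygy of the Koszul complex `x : M → M`. -/
def smulPullback {M F : Type u} [AddCommGroup M] [Module R M] [AddCommGroup F] [Module R F]
    (x : R) (π : F →ₗ[R] M) : Submodule R (M × F) :=
  LinearMap.eqLocus (x • LinearMap.fst R M F) (π ∘ₗ LinearMap.snd R M F)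

section smulPullback

variable {M F : Type u} [AddCommGroup M] [Module R M] [AddCommGroup F] [Module R F]

lemma mem_smulPullback {x : R} {π : F →ₗ[R] M} {w : M × F} :
    w ∈ smulPullback x π ↔ x • w.1 = π w.2 := Iff.rfl

/-- Multiplication by `x` is null-homotopic on the Koszul complex `x : M → M`. -/
lemma self_mem_stableAnnihilator_smulPullback [Module.Finite R F] [Module.Projective R F]
    (x : R) (π : F →ₗ[R] M) : x ∈ stableAnnihilator R (smulPullback x π) := by
  rw [mem_stableAnnihilator_iff]
  refine ⟨F, _, _, inferInstance, inferInstance,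
    LinearMap.snd R M F ∘ₗ (smulPullback x π).subtype,
    (π.prod (x • LinearMap.id)).codRestrict _ fun f => by simp [mem_smulPullback], ?_⟩
  rintro ⟨⟨m, f⟩, hw⟩
  rw [mem_smulPullback] at hw
  ext <;> simp [← hw]

/-- The pullback construction is functorial up to maps through `F`: a factorization
`y • id_M = h ∘ g` through a projective `P` induces one of `y • id` on the pullback, through
`P × F`. -/
lemma stableAnnihilator_le_smulPullback [Module.Finite R F] [Module.Projective R F]
    (x : R) {π : F →ₗ[R] M} (hπ : Function.Surjective π) :
    stableAnnihilator R M ≤ stableAnnihilator R (smulPullback x π) := by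
  intro y hy
  rw [mem_stableAnnihilator_iff] at hy ⊢
  obtain ⟨P, _, _, hP, hP', g, h, e⟩ := hy
  obtain ⟨l, hl⟩ := Module.projective_lifting_property π h hπ
  replace hl : ∀ q, π (l q) = h q := LinearMap.congr_fun hl
  -- `l ∘ g ∘ π` and `y • id` both lift `y • id_M` along `π`; `d` is their difference.
  let d : F →ₗ[R] F := y • LinearMap.id - l ∘ₗ g ∘ₗ π
  have hd : ∀ f, π (d f) = 0 := by simp [d, hl, e]
  refine ⟨P × F, inferInstance, inferInstance, inferInstance, inferInstance,
    (g.prodMap LinearMap.id) ∘ₗ (smulPullback x π).subtype,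
    ((h.prod (x • l)).coprod (LinearMap.prod 0 d)).codRestrict _ fun w => by
      simp [mem_smulPullback, hl, hd], ?_⟩
  rintro ⟨⟨m, f⟩, hw⟩
  rw [mem_smulPullback] at hw
  ext
  · simp [e]
  · simp [d, ← hw]

/-- If `x • id_M` factors through a projective module, it lifts along `π`, which splits the
projection of the pullback onto `M`. -/
lemma exists_retract_smulPullback {x : R} {π : F →ₗ[R] M} (hπ : Function.Surjective π)
    (hx : x ∈ stableAnnihilator R M) :
    ∃ (i : M →ₗ[R] smulPullback x π) (r : smulPullback x π →ₗ[R] M), ∀ m, r (i m) = m := by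
  rw [mem_stableAnnihilator_iff] at hx
  obtain ⟨P, _, _, hP, hP', g, h, e⟩ := hx
  obtain ⟨l, hl⟩ := Module.projective_lifting_property π h hπ
  replace hl : ∀ q, π (l q) = h q := LinearMap.congr_fun hl
  exact ⟨(LinearMap.id.prod (l ∘ₗ g)).codRestrict _ fun m => by simp [mem_smulPullback, hl, e],
    LinearMap.fst R M F ∘ₗ (smulPullback x π).subtype, fun m => rfl⟩

/-- The octahedron on `x ^ (n + 1) = x * x ^ n`, realized as an exact sequence
`0 → W (x ^ n) → W (x ^ (n + 1)) × F → W x → 0` of pullbacks. -/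
lemma exists_shortExact_smulPullback (x : R) (n : ℕ) {π : F →ₗ[R] M}
    (hπ : Function.Surjective π) :
    ∃ (i : smulPullback (x ^ n) π →ₗ[R] smulPullback (x ^ (n + 1)) π × F)
      (p : smulPullback (x ^ (n + 1)) π × F →ₗ[R] smulPullback x π),
      Function.Injective i ∧ Function.Exact i p ∧ Function.Surjective p := by
  let W := smulPullback (x ^ (n + 1)) π
  let i : smulPullback (x ^ n) π →ₗ[R] W × F :=
    (((LinearMap.id.prodMap (x • LinearMap.id)) ∘ₗ (smulPullback (x ^ n) π).subtype).codRestrict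
      W (by
        rintro ⟨⟨m, f⟩, hw⟩
        rw [mem_smulPullback] at hw
        simp [W, mem_smulPullback, pow_succ', mul_smul, hw])).prod
      (-(LinearMap.snd R M F ∘ₗ (smulPullback (x ^ n) π).subtype))
  let p : W × F →ₗ[R] smulPullback x π :=
    ((((x ^ n) • LinearMap.id).prodMap LinearMap.id ∘ₗ W.subtype).coprod
      (π.prod (x • LinearMap.id))).codRestrict _ (by
        rintro ⟨⟨⟨m, f⟩, hw⟩, f'⟩
        rw [mem_smulPullback] at hw
        simp only [pow_succ', mul_smul] at hw
        simp [mem_smulPullback, hw])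
  have hi : ∀ w, i w = (⟨(w.1.1, x • w.1.2), (i w).1.2⟩, -w.1.2) := fun w => rfl
  have hp : ∀ w, (p w).1 = (x ^ n • w.1.1.1 + π w.2, w.1.1.2 + x • w.2) := fun w => rfl
  refine ⟨i, p, ?_, ?_, ?_⟩
  · intro v w h
    have h₁ : v.1.1 = w.1.1 := congrArg (fun z => z.1.1.1) h
    have h₂ : -v.1.2 = -w.1.2 := congrArg Prod.snd h
    exact Subtype.ext (Prod.ext h₁ (neg_injective h₂))
  · intro w
    constructor
    · intro h
      have h' := congrArg Subtype.val h
      rw [hp] at h'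
      simp only [ZeroMemClass.coe_zero, Prod.mk_eq_zero] at h'
      refine ⟨⟨(w.1.1.1, -w.2), ?_⟩, ?_⟩
      · rw [mem_smulPullback, map_neg]
        exact eq_neg_of_add_eq_zero_left h'.1
      · rw [hi]
        refine Prod.ext (Subtype.ext (Prod.ext rfl ?_)) (neg_neg _)
        simpa using (eq_neg_of_add_eq_zero_left h'.2).symm
    · rintro ⟨v, rfl⟩
      have hv := mem_smulPullback.1 v.2
      refine Subtype.ext ?_
      rw [hp, hi]
      simp [hv]
  · intro v
    have hv := mem_smulPullback.1 v.2
    obtain ⟨f', hf'⟩ := hπ v.1.1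
    refine ⟨(⟨(0, v.1.2 - x • f'), ?_⟩, f'), ?_⟩
    · simp [mem_smulPullback, hf', hv]
    · refine Subtype.ext ?_
      rw [hp]
      simp [hf']

end smulPullback

/-! ### The nonfree locus -/

/-- If `M_p` is free, the localization at `p` of a finite free cover of `M` splits, and clearing
denominators in a splitting factors a multiple `a • id_M` with `a ∉ p` through the cover. -/
lemma exists_notMem_mem_stableAnnihilator [IsNoetherianRing R] {M : Type u} [AddCommGroup M]
    [Module R M] [Module.Finite R M] {p : PrimeSpectrum R} (hp : p ∉ nonfreeLocus R M) :
    ∃ a ∈ stableAnnihilator R M, a ∉ p.asIdeal := by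
  have hfree : Module.Free (Localization.AtPrime p.asIdeal)
      (LocalizedModule p.asIdeal.primeCompl M) := not_not.1 hp
  set S := p.asIdeal.primeCompl
  obtain ⟨n, π, hπ⟩ := Module.Finite.exists_fin' R M
  have : Module.FinitePresentation R M := Module.finitePresentation_of_finite R M
  obtain ⟨s, hs⟩ := Module.projective_lifting_property
    (LocalizedModule.map S π) LinearMap.id (LocalizedModule.map_surjective S π hπ)
  obtain ⟨g, a, hg⟩ := Module.FinitePresentation.exists_lift_of_isLocalizedModule S
    (LocalizedModule.mkLinearMap S (Fin n → R))
    (s.restrictScalars R ∘ₗ LocalizedModule.mkLinearMap S M)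
  have key : LocalizedModule.mkLinearMap S M ∘ₗ (π ∘ₗ g) =
      LocalizedModule.mkLinearMap S M ∘ₗ (a • LinearMap.id) := by
    ext m
    have hg' := congrArg (LocalizedModule.map S π) (LinearMap.congr_fun hg m)
    have hs' := LinearMap.congr_fun hs (LocalizedModule.mkLinearMap S M m)
    simp only [LinearMap.comp_apply, LinearMap.id_apply, LinearMap.smul_apply,
      LinearMap.coe_restrictScalars, LinearMap.map_smul_of_tower] at hg' hs' ⊢
    rwa [hs', LocalizedModule.mkLinearMap_apply, LocalizedModule.map_mk] at hg'
  obtain ⟨b, hb⟩ := Module.Finite.exists_smul_of_comp_eq_of_isLocalizedModule S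
    (LocalizedModule.mkLinearMap S M) _ _ key
  refine ⟨(b * a : S), mem_stableAnnihilator_iff.2 ⟨Fin n → R, _, _, inferInstance, inferInstance,
    g, (b : R) • π, fun m => ?_⟩, (b * a).2⟩
  have := LinearMap.congr_fun hb m
  simpa [mul_smul, Submonoid.smul_def] using this

/-- Over the local ring `R_p`, a direct summand of a finitely generated projective module is
free. -/
lemma notMem_nonfreeLocus [IsNoetherianRing R] {M : Type u} [AddCommGroup M]
    [Module R M] [Module.Finite R M] {p : PrimeSpectrum R} {a : R}
    (ha : a ∈ stableAnnihilator R M) (hap : a ∉ p.asIdeal) : p ∉ nonfreeLocus R M := by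
  rw [mem_stableAnnihilator_iff] at ha
  obtain ⟨P, _, _, hP, hP', g, h, e⟩ := ha
  refine not_not.2 ?_
  set S := p.asIdeal.primeCompl
  let A := Localization.AtPrime p.asIdeal
  obtain ⟨u, hu⟩ : IsUnit (algebraMap R A a) := IsLocalization.map_units A (⟨a, hap⟩ : S)
  have hproj : Module.Projective A (LocalizedModule S P) := 
    Module.projective_of_isLocalizedModule S (LocalizedModule.mkLinearMap S P)
  have : Module.Projective A (LocalizedModule S M) := by
    refine Module.Projective.of_split (LocalizedModule.map S g)
      ((↑u⁻¹ : A) • LocalizedModule.map S h) ?_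
    ext z
    induction z using LocalizedModule.induction_on with
    | h m t =>
      rw [LinearMap.comp_apply, LinearMap.smul_apply, LocalizedModule.map_mk,
        LocalizedModule.map_mk, e, ← LocalizedModule.smul'_mk, ← algebraMap_smul A a, ← hu,
        smul_smul, Units.inv_mul, one_smul, LinearMap.id_apply]
  exact Module.free_of_flat_of_isLocalRing

/-- The nonfree locus of `M` is the closed set defined by the stable annihilator. -/
lemma nonfreeLocus_subset_zeroLocus_iff [IsNoetherianRing R] {M : Type u} [AddCommGroup M]
    [Module R M] [Module.Finite R M] {I : Ideal R} :
    nonfreeLocus R M ⊆ PrimeSpectrum.zeroLocus (I : Set R) ↔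
      I ≤ (stableAnnihilator R M).radical := by
  constructor
  · intro H
    rw [Ideal.radical_eq_sInf]
    refine le_sInf fun q ⟨hq, hq'⟩ => ?_
    by_contra hI
    obtain ⟨a, ha, haq⟩ := exists_notMem_mem_stableAnnihilator (M := M) (p := ⟨q, hq'⟩)
      fun h => hI (H h)
    exact haq (hq ha)
  · intro H p hp x hx
    obtain ⟨n, hn⟩ := H hx
    by_contra hxp
    exact notMem_nonfreeLocus hn (fun h => hxp (p.2.mem_of_pow_mem n h)) hp

end Algebra

/-! ### Subcategories of finitely generated modules -/

section Category

open CategoryTheory.Limits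

variable {R : Type u} [CommRing R]

lemma prop_of_retract (P : ObjectProperty (FGModuleCat.{u} R)) [P.IsStableUnderRetracts]
    {M N : Type u} [AddCommGroup M] [Module R M] [AddCommGroup N] [Module R N]
    [Module.Finite R M] [Module.Finite R N] (i : M →ₗ[R] N) (r : N →ₗ[R] M)
    (hri : ∀ m, r (i m) = m) (hN : P (.of R N)) : P (.of R M) :=
  P.prop_of_retract ⟨FGModuleCat.ofHom i, FGModuleCat.ofHom r, by ext m; exact hri m⟩ hN

lemma modIdeal_of_projective (I : Ideal R) {M : Type u} [AddCommGroup M] [Module R M]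
    [Module.Finite R M] [Module.Projective R M] : modIdeal R I (.of R M) :=
  le_top.trans_eq stableAnnihilator_eq_top.symm

lemma isStableUnderRetracts_modIdeal (I : Ideal R) : (modIdeal R I).IsStableUnderRetracts where
  of_retract r h := le_trans h <| stableAnnihilator_le_of_retract r.i.hom.hom r.r.hom.hom
    fun m => congr($(r.retract).hom.hom m)

lemma nonempty_of_modIdeal_le {I : Ideal R} {P : ObjectProperty (FGModuleCat.{u} R)}
    (h : modIdeal R I ≤ P) : P.Nonempty :=
  ⟨.of R R, h _ (modIdeal_of_projective I)⟩

variable [IsNoetherianRing R]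

lemma shortExact_iff (S : ShortComplex (FGModuleCat.{u} R)) :
    S.ShortExact ↔ Function.Injective S.f.hom.hom ∧
      Function.Exact S.f.hom.hom S.g.hom.hom ∧ Function.Surjective S.g.hom.hom := by
  let F := forget₂ (FGModuleCat.{u} R) (ModuleCat.{u} R)
  constructor
  · intro h
    have := h.map_of_exact F
    exact ⟨this.moduleCat_injective_f,
      (ShortComplex.ShortExact.moduleCat_exact_iff_function_exact _).1 this.exact,
      this.moduleCat_surjective_g⟩
  · rintro ⟨h1, h2, h3⟩
    have hf : Mono (F.map S.f) := (ModuleCat.mono_iff_injective _).2 h1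
    have hg : Epi (F.map S.g) := (ModuleCat.epi_iff_surjective _).2 h3
    exact .mk' ((ShortComplex.exact_map_iff_of_faithful S F).1
      ((ShortComplex.ShortExact.moduleCat_exact_iff_function_exact _).2 h2))
      (F.mono_of_mono_map hf) (F.epi_of_epi_map hg)

lemma prop_of_exact (P : ObjectProperty (FGModuleCat.{u} R)) [P.IsClosedUnderExtensions]
    {L M N : Type u} [AddCommGroup L] [Module R L] [AddCommGroup M]
    [Module R M] [AddCommGroup N] [Module R N] [Module.Finite R L] [Module.Finite R M]
    [Module.Finite R N] {i : L →ₗ[R] M} {p : M →ₗ[R] N}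
    (hi : Function.Injective i) (hip : Function.Exact i p) (hp : Function.Surjective p)
    (hL : P (.of R L)) (hN : P (.of R N)) : P (.of R M) :=
  P.prop_X₂_of_shortExact (S := ShortComplex.mk (FGModuleCat.ofHom i) (FGModuleCat.ofHom p)
    (by ext m; exact hip.apply_apply_eq_zero m)) ((shortExact_iff _).2 ⟨hi, hip, hp⟩) hL hN

/-- In an abelian category, binary products are split extensions. -/
lemma isClosedUnderFiniteProducts_of_extensions {C : Type*} [Category* C] [Abelian C]
    (P : ObjectProperty C) [P.Nonempty] [P.IsStableUnderRetracts] [P.IsClosedUnderExtensions] :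
    P.IsClosedUnderFiniteProducts := by
  have : P.IsClosedUnderBinaryProducts := .mk' (by
    rintro _ ⟨F, hF⟩
    have e : F.obj ⟨.left⟩ ⊞ F.obj ⟨.right⟩ ≅ limit F :=
      biprod.isoProd _ _ ≪≫ HasLimit.isoOfNatIso (diagramIsoPair F).symm
    exact P.prop_of_iso e (P.prop_biprod (hF _) (hF _)))
  exact .mk'

lemma modLocus_iff (I : Ideal R) (M : FGModuleCat.{u} R) :
    modLocus R (PrimeSpectrum.zeroLocus (I : Set R)) M ↔ I ≤ (stableAnnihilator R M).radical :=
  nonfreeLocus_subset_zeroLocus_iff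

lemma modIdeal_le_modLocus (I : Ideal R) :
    modIdeal R I ≤ modLocus R (PrimeSpectrum.zeroLocus (I : Set R)) := fun M h =>
  (modLocus_iff I M).2 (le_trans h Ideal.le_radical)

lemma isStableUnderRetracts_modLocus (I : Ideal R) :
    (modLocus R (PrimeSpectrum.zeroLocus (I : Set R))).IsStableUnderRetracts where
  of_retract r h := (modLocus_iff I _).2 <| ((modLocus_iff I _).1 h).trans <|
    Ideal.radical_mono <| stableAnnihilator_le_of_retract r.i.hom.hom r.r.hom.hom
      fun m => congr($(r.retract).hom.hom m)

lemma isClosedUnderExtensions_modLocus (I : Ideal R) :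
    (modLocus R (PrimeSpectrum.zeroLocus (I : Set R))).IsClosedUnderExtensions where
  prop_X₂_of_shortExact {S} hS h₁ h₃ := by
    rw [modLocus_iff] at h₁ h₃ ⊢
    obtain ⟨hi, hip, hp⟩ := (shortExact_iff S).1 hS
    refine le_trans ?_ (Ideal.radical_mono (stableAnnihilator_mul_le hi hip hp))
    rw [Ideal.radical_mul]
    exact le_inf h₁ h₃

lemma prop_smulPullback_pow {I : Ideal R} {P : ObjectProperty (FGModuleCat.{u} R)}
    (hP : modIdeal R I ≤ P) [P.IsStableUnderRetracts] [P.IsClosedUnderExtensions]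
    {M F : Type u} [AddCommGroup M] [Module R M] [AddCommGroup F] [Module R F]
    [Module.Finite R M] [Module.Finite R F] [Module.Projective R F] {x : R} {π : F →ₗ[R] M}
    (hπ : Function.Surjective π) (hx : P (.of R (smulPullback x π))) (n : ℕ) :
    P (.of R (smulPullback (x ^ n) π)) := by
  induction n with
  | zero =>
    -- `x ^ 0 = 1` annihilates the stable endomorphisms, so the pullback is projective.
    have := self_mem_stableAnnihilator_smulPullback (x ^ 0) π
    rw [pow_zero, ← Ideal.eq_top_iff_one] at this
    exact hP _ (le_top.trans_eq (by rw [pow_zero]; exact this.symm))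
  | succ n ih =>
    obtain ⟨i, p, hi, hip, hp⟩ := exists_shortExact_smulPullback x n hπ
    exact prop_of_retract P (LinearMap.inl R _ F) (LinearMap.fst R _ F) (fun _ => rfl)
      (prop_of_exact P hi hip hp ih hx)

/-- Noetherian induction on the stable annihilator: an `x ∈ I` outside it enlarges it when `M` is
replaced by the pullback along `x`, and `M` is a direct summand of the pullback along a power of
`x`. -/
lemma prop_of_le_radical {I : Ideal R} {P : ObjectProperty (FGModuleCat.{u} R)}
    (hP : modIdeal R I ≤ P) [P.IsStableUnderRetracts] [P.IsClosedUnderExtensions]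
    (M : FGModuleCat.{u} R) (hM : I ≤ (stableAnnihilator R M).radical) : P M := by
  induction hJ : stableAnnihilator R M using WellFoundedGT.induction generalizing M with
  | ind J ih =>
    subst hJ
    by_cases hI : I ≤ stableAnnihilator R M
    · exact hP M hI
    obtain ⟨x, hxI, hx⟩ := SetLike.not_le_iff_exists.1 hI
    obtain ⟨n, hn⟩ := hM hxI
    obtain ⟨k, π, hπ⟩ := Module.Finite.exists_fin' R M
    have hle := stableAnnihilator_le_smulPullback x hπ
    have hself := self_mem_stableAnnihilator_smulPullback x π
    have hW : P (.of R (smulPullback x π)) :=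
      ih _ (SetLike.lt_iff_le_and_exists.2 ⟨hle, x, hself, hx⟩) (.of R (smulPullback x π))
        (hM.trans (Ideal.radical_mono hle)) rfl
    obtain ⟨i, r, hri⟩ := exists_retract_smulPullback hπ hn
    exact prop_of_retract P i r hri (prop_smulPullback_pow hP hπ hW n)

lemma extClosure_modIdeal (I : Ideal R) :
    extClosure R (modIdeal R I) = modLocus R (PrimeSpectrum.zeroLocus (I : Set R)) := by
  ext M
  constructor
  · intro h
    have := isStableUnderRetracts_modLocus I
    have := isClosedUnderExtensions_modLocus I
    have := nonempty_of_modIdeal_le (modIdeal_le_modLocus I)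
    exact h _ (modIdeal_le_modLocus I) (isClosedUnderFiniteProducts_of_extensions _) ‹_› ‹_›
  · intro h P hP _ _ _
    exact prop_of_le_radical hP M ((modLocus_iff I M).1 h)

end Category

end StableAnn

theorem proposition2p9 (R : Type u) [CommRing R] [IsNoetherianRing R] (I : Ideal R) :
    StableAnn.extClosure R (StableAnn.modIdeal R I) =
        StableAnn.modLocus R (PrimeSpectrum.zeroLocus (I : Set R)) ∧
      ((StableAnn.modIdeal R I).IsClosedUnderExtensions ↔
        StableAnn.modIdeal R I =
          StableAnn.modLocus R (PrimeSpectrum.zeroLocus (I : Set R))) := by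
  refine ⟨StableAnn.extClosure_modIdeal I, fun _ => ?_, fun h => ?_⟩
  · have := StableAnn.isStableUnderRetracts_modIdeal I
    exact le_antisymm (StableAnn.modIdeal_le_modLocus I) fun M hM =>
      StableAnn.prop_of_le_radical le_rfl M ((StableAnn.modLocus_iff I M).1 hM)
  · rw [h]
    exact StableAnn.isClosedUnderExtensions_modLocus I
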